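/- **Theorem.** Let $\mathbb D=\{z:|z|<1\}$, let $\lambda\ge 0$, and let $\mathcal B_H(\lambda)$ be the class of sense-preserving harmonic mappings $f=h+\overline g$ of $\mathbb D$ ($h,g$ analytic in $\mathbb D$, $J_f=|h'|^2-|g'|^2>0$), normalized by $h(0)=g(0)=0$, $h'(0)=1$, whose pre-Schwarzian derivative $$P_f=\frac{h''\overline{h'}-g''\overline{g'}}{|h'|^2-|g'|^2}$$ satisfies $\|P_f\|=\sup_{z\in\mathbb D}(1-|z|^2)|P_f(z)|\le\lambda$. Write $h(z)=\sum_{n\ge1}a_nz^n$, $g(z)=\sum_{n\ge1}b_nz^n$, and put $$I_p(r,F)=\frac1{2\pi}\int_0^{2\pi}|F(re^{i\theta})|^p\,d\theta,\qquad \alpha(x)=\frac{\sqrt{1+4x^2}-1}{2}.$$ Let $f=h+\overline g\in\mathcal B_H(\lambda)$ and $a>0$. Then the following hold. 1. For every real $p$, $$I_p(r,h'+\varepsilon g')=O\left((1-r)^{-\alpha(|p|(\lambda+1)/2)-a}\right)\quad (r\to1^-),$$ uniformly for $\varepsilon$ in the closed disk $|\varepsilon|\le1$. 2. $|a_n|+|b_n|=O\left(n^{\alpha((\lambda+1)/2)-1+a}\right)$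 as $n\to\infty$. 3. For every $p>0$, $$I_p(r,f)=O\left((1-r)^{\min\{p-\alpha(p(\lambda+1)/2)-a,\;0\}}\right)\quad (r\to1^-);$$ that is, $I_p(r,f)=O\left((1-r)^{p-\alpha(p(\lambda+1)/2)-a}\right)$ when this exponent is negative, and $I_p(r,f)$ is bounded otherwise. -/

import Mathlib

open Filter Asymptotics
open scoped Topology ComplexConjugate Nat

noncomputable section

namespace HarmonicDisk

/-- The open unit disk in the complex plane. -/
def disk : Set ℂ := Metric.ball 0 1

/-- `f = h + conj g` on the disk, with `h` and `g` analytic there and `g 0 = 0`: the canonical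
representation of a complex-valued harmonic function of the disk. -/
structure IsCanonicalRep (f h g : ℂ → ℂ) : Prop where
  analytic_h : DifferentiableOn ℂ h disk
  analytic_g : DifferentiableOn ℂ g disk
  eq_add_conj : ∀ z ∈ disk, f z = h z + conj (g z)
  g_zero : g 0 = 0

/-- The Jacobian of `h + conj g`. -/
def jacobian (h g : ℂ → ℂ) (z : ℂ) : ℝ := ‖deriv h z‖ ^ 2 - ‖deriv g z‖ ^ 2

/-- The pre-Schwarzian derivative of `h + conj g`. -/
def preSchwarzian (h g : ℂ → ℂ) (z : ℂ) : ℂ :=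
  (deriv (deriv h) z * conj (deriv h z) - deriv (deriv g) z * conj (deriv g z)) /
    (jacobian h g z : ℂ)

/-- The pre-Schwarzian norm of `h + conj g`, with value `∞` if the supremum is infinite. -/
def preSchwarzianNorm (h g : ℂ → ℂ) : ENNReal :=
  ⨆ z ∈ disk, ENNReal.ofReal ((1 - ‖z‖ ^ 2) * ‖preSchwarzian h g z‖)

/-- `f = h + conj g` is a sense-preserving harmonic mapping of the disk with the normalization
`h 0 = 0`, `h' 0 = 1`, `g 0 = 0`. -/
structure IsNormalizedHarmonic (f h g : ℂ → ℂ) : Prop extends IsCanonicalRep f h g where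
  sense_preserving : ∀ z ∈ disk, 0 < jacobian h g z
  h_zero : h 0 = 0
  deriv_h_zero : deriv h 0 = 1

/-- `f = h + conj g` belongs to the class `B_H(lam)`. -/
structure IsInBH (lam : ℝ) (f h g : ℂ → ℂ) : Prop extends IsNormalizedHarmonic f h g where
  norm_le : preSchwarzianNorm h g ≤ ENNReal.ofReal lam

/-- The integral mean `I_p(r, F)`: the average of `|F| ^ p` over the circle `|z| = r`. -/
def integralMean (p r : ℝ) (F : ℂ → ℂ) : ℝ :=
  Real.circleAverage (fun z => ‖F z‖ ^ p) 0 r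

/-- The `n`-th Taylor coefficient of `F` at the origin. -/
def taylorCoeff (F : ℂ → ℂ) (n : ℕ) : ℂ := iteratedDeriv n F 0 / (n ! : ℂ)

/-- The function `x ↦ (√(1 + 4 x ^ 2) - 1) / 2`. -/
def alpha (x : ℝ) : ℝ := (Real.sqrt (1 + 4 * x ^ 2) - 1) / 2

end HarmonicDisk

end

namespace HarmonicDisk

/-! Everything rests on one pointwise estimate: for `|ε| ≤ 1`, `F = h' + ε g'` has no zeros and `(1
- |z|²) |F'/F| ≤ λ + 1` (`IsInBH.logDerivBound`). Indeed `J_f F'` equals `F` times the numerator of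
`P_f`, plus the Wronskian of `h', g'` times `conj g' + ε conj h'`. The first term costs `λ`. The
second costs `1`, by Schwarz–Pick for the dilatation `g'/h'` and `|conj g' + ε conj h'| ≤ |F|`.

Hence `K = F^(p/2)` satisfies `(1 - |z|²) |K'| ≤ x |K|` with `x = |p| (λ + 1) / 2`. By Parseval, the
mean `B(t)` of `|K|²` on `|z|² = t` is a power series with nonnegative coefficients, and `(t B')' ≤
x² (1 - t)⁻² B`. Since `α(x)` is the nonnegative root of `α (α + 1) = x²`, the function `(1 -
t)^(-β)` with `β > α(x)` satisfies the reverse inequality near `t = 1`, and a Wronskian comparison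
bounds `B` by it (`tsum_pow_le_of_differential_ineq`). This gives the means of `h' + ε g'`.

The coefficient bound is Cauchy's estimate for `h'` and `g'` on `|z| = 1 - 1/n`, with `p = 1`. For
the means of `f`, each radius is cut at `1 - 2⁻ᵏ`; `|h'|` is essentially constant on each piece, so
`|f|` is at most a constant times `∑ 2⁻ᵏ |h'|` over the cut points, and the bound on the means of
`h'` is summed geometrically. -/

theorem isOpen_disk : IsOpen disk := Metric.isOpen_ball

theorem mem_disk_iff {z : ℂ} : z ∈ disk ↔ ‖z‖ < 1 := mem_ball_zero_iff

theorem closedBall_subset_disk {r : ℝ} (hr : r < 1) : Metric.closedBall 0 r ⊆ disk :=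
  Metric.closedBall_subset_ball hr

theorem circleMap_mem_disk {r : ℝ} (hr : 0 ≤ r) (hr1 : r < 1) (θ : ℝ) : circleMap 0 r θ ∈ disk := by
  rw [mem_disk_iff, norm_circleMap_zero, abs_of_nonneg hr]
  exact hr1

theorem circleIntegrable_of_continuousOn_disk {E : Type*} [NormedAddCommGroup E] {F : ℂ → E}
    (hF : ContinuousOn F disk) {r : ℝ} (hr : 0 ≤ r) (hr1 : r < 1) : CircleIntegrable F 0 r :=
  ContinuousOn.circleIntegrable hr
    (hF.mono (Metric.sphere_subset_closedBall.trans (closedBall_subset_disk hr1)))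

/-! ### Taylor coefficients and Parseval's identity -/

theorem hasSum_taylorCoeff {F : ℂ → ℂ} (hF : DifferentiableOn ℂ F disk) {z : ℂ} (hz : z ∈ disk) :
    HasSum (fun n : ℕ => taylorCoeff F n * z ^ n) (F z) := by
  have h : (fun n : ℕ => taylorCoeff F n * z ^ n) =
      fun n : ℕ => (n ! : ℂ)⁻¹ • (z - 0) ^ n • iteratedDeriv n F 0 := by
    funext n
    rw [taylorCoeff, sub_zero, smul_eq_mul, smul_eq_mul]
    ring
  rw [h]
  exact Complex.hasSum_taylorSeries_on_ball hF hz

theorem summable_norm_taylorCoeff {F : ℂ → ℂ} (hF : DifferentiableOn ℂ F disk) {r : ℝ}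
    (hr : 0 ≤ r) (hr1 : r < 1) : Summable (fun n : ℕ => ‖taylorCoeff F n‖ * r ^ n) := by
  have hz : (r : ℂ) ∈ disk := by
    rw [mem_disk_iff, Complex.norm_real, Real.norm_of_nonneg hr]
    exact hr1
  refine (hasSum_taylorCoeff hF hz).summable.norm.congr fun n => ?_
  rw [norm_mul, norm_pow, Complex.norm_real, Real.norm_of_nonneg hr]

theorem taylorCoeff_deriv (F : ℂ → ℂ) (n : ℕ) :
    taylorCoeff (deriv F) n = (n + 1) * taylorCoeff F (n + 1) := by
  have h1 : (n ! : ℂ) ≠ 0 := by exact_mod_cast n.factorial_ne_zero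
  have h2 : ((n : ℂ) + 1) ≠ 0 := by exact_mod_cast n.succ_ne_zero
  rw [taylorCoeff, taylorCoeff, iteratedDeriv_succ', Nat.factorial_succ]
  push_cast
  field_simp

/-- The Cauchy formula for the Taylor coefficients, with `z⁻¹` replaced by `conj z`. -/
theorem circleAverage_conj_pow_mul {F : ℂ → ℂ} (hF : DifferentiableOn ℂ F disk) {r : ℝ}
    (hr : 0 ≤ r) (hr1 : r < 1) (n : ℕ) :
    Real.circleAverage (fun z => conj z ^ n * F z) 0 r = r ^ (2 * n) * taylorCoeff F n := by
  rcases hr.eq_or_lt with rfl | hr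
  · rcases n with _ | n <;> simp [taylorCoeff]
  have hd : DiffContOnCl ℂ F (Metric.ball 0 r) :=
    (hF.mono (closure_minimal Metric.ball_subset_closedBall
      Metric.isClosed_closedBall |>.trans (closedBall_subset_disk hr1))).diffContOnCl
  have hC := hd.circleIntegral_one_div_sub_center_pow_smul hr n
  rw [Real.circleAverage_eq_circleIntegral hr.ne']
  have h1 : (∮ z in C(0, r), (z - 0)⁻¹ • (conj z ^ n * F z)) =
      ∮ z in C(0, r), (r ^ (2 * n) : ℂ) • ((1 / (z - 0) ^ (n + 1)) • F z) := by
    refine circleIntegral.integral_congr hr.le fun z hz => ?_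
    have hz' : ‖z‖ = r := by simpa using hz
    have hz0 : z ≠ 0 := by
      rintro rfl
      simp at hz'
      exact hr.ne hz'
    have h2 : conj z = (r : ℂ) ^ 2 / z := by
      rw [eq_div_iff hz0, mul_comm, Complex.mul_conj, Complex.normSq_eq_norm_sq, hz']
      push_cast
      rfl
    simp only [h2, smul_eq_mul, sub_zero, div_pow, ← pow_mul]
    field_simp
    ring
  rw [h1, circleIntegral.integral_smul, hC, taylorCoeff]
  have h3 : (2 * (Real.pi : ℂ) * Complex.I) ≠ 0 := Complex.two_pi_I_ne_zero
  simp only [smul_eq_mul]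
  field_simp

/-- Parseval's identity on the circles of the unit disk. -/
theorem hasSum_sq_norm_taylorCoeff {F : ℂ → ℂ} (hF : DifferentiableOn ℂ F disk) {r : ℝ}
    (hr : 0 ≤ r) (hr1 : r < 1) :
    HasSum (fun n : ℕ => ‖taylorCoeff F n‖ ^ 2 * r ^ (2 * n))
      (Real.circleAverage (fun z => ‖F z‖ ^ 2) 0 r) := by
  have hc : ∀ G : ℂ → ℂ, ContinuousOn G disk → Continuous fun θ => G (circleMap 0 r θ) :=
    fun G hG => hG.comp_continuous (continuous_circleMap _ _) (circleMap_mem_disk hr hr1)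
  have hcF := hc F hF.continuousOn
  obtain ⟨M, hM⟩ : ∃ M, ∀ z ∈ Metric.closedBall (0 : ℂ) r, ‖F z‖ ≤ M :=
    (isCompact_closedBall 0 r).exists_bound_of_continuousOn
      (hF.continuousOn.mono (closedBall_subset_disk hr1))
  have hM' : ∀ θ, ‖F (circleMap 0 r θ)‖ ≤ M := fun θ => hM _ (circleMap_mem_closedBall 0 hr θ)
  have hsum : Summable (fun n : ℕ => M * (‖taylorCoeff F n‖ * r ^ n)) :=
    (summable_norm_taylorCoeff hF hr hr1).mul_left M
  -- The Taylor series is integrated termwise against `conj F`; each resulting integral is the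
  -- conjugate of a Cauchy coefficient integral.
  have key := intervalIntegral.hasSum_integral_of_dominated_convergence
    (μ := MeasureTheory.volume) (a := 0) (b := 2 * Real.pi)
    (F := fun (n : ℕ) θ => conj (F (circleMap 0 r θ)) * (taylorCoeff F n * circleMap 0 r θ ^ n))
    (f := fun θ => conj (F (circleMap 0 r θ)) * F (circleMap 0 r θ))
    (fun n _ => M * (‖taylorCoeff F n‖ * r ^ n))
    (fun n => Continuous.aestronglyMeasurable 
      ((Complex.continuous_conj.comp hcF).mul
        (continuous_const.mul ((continuous_circleMap 0 r).pow n))))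
    (fun n => Eventually.of_forall fun θ _ => by
      rw [norm_mul, norm_mul, norm_pow, norm_circleMap_zero, abs_of_nonneg hr, RCLike.norm_conj]
      gcongr
      exact hM' θ)
    (Eventually.of_forall fun θ _ => hsum)
    intervalIntegrable_const
    (Eventually.of_forall fun θ _ =>
      (hasSum_taylorCoeff hF (circleMap_mem_disk hr hr1 θ)).mul_left _)
  have key2 := (key.const_smul ((2 * Real.pi : ℝ)⁻¹))
  rw [← Complex.hasSum_ofReal]
  have e1 : ∀ n : ℕ, ((2 * Real.pi : ℝ)⁻¹) • ∫ θ in (0)..(2 * Real.pi),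
      conj (F (circleMap 0 r θ)) * (taylorCoeff F n * circleMap 0 r θ ^ n) =
      ((‖taylorCoeff F n‖ ^ 2 * r ^ (2 * n) : ℝ) : ℂ) := by
    intro n
    have h1 := circleAverage_conj_pow_mul hF hr hr1 n
    have h2 : Real.circleAverage (fun z => conj (conj z ^ n * F z)) 0 r =
        conj ((r : ℂ) ^ (2 * n) * taylorCoeff F n) := by
      rw [← h1]
      exact (Complex.conjCLE : ℂ →L[ℝ] ℂ).circleAverage_comp_comm
        (circleIntegrable_of_continuousOn_disk
          ((Complex.continuous_conj.pow n).continuousOn.mul hF.continuousOn) hr hr1)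
    have h3 : Real.circleAverage (fun z => taylorCoeff F n • conj (conj z ^ n * F z)) 0 r =
        taylorCoeff F n * conj ((r : ℂ) ^ (2 * n) * taylorCoeff F n) := by
      rw [Real.circleAverage_fun_smul, h2, smul_eq_mul]
    rw [Real.circleAverage_def] at h3
    rw [show taylorCoeff F n * conj ((r : ℂ) ^ (2 * n) * taylorCoeff F n) =
      ((‖taylorCoeff F n‖ ^ 2 * r ^ (2 * n) : ℝ) : ℂ) by
        simp only [map_mul, map_pow, Complex.conj_ofReal]
        rw [mul_left_comm, Complex.mul_conj, Complex.normSq_eq_norm_sq]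
        push_cast
        ring] at h3
    rw [← h3]
    congr 1
    refine intervalIntegral.integral_congr fun θ _ => ?_
    simp only [map_mul, map_pow, Complex.conj_conj, smul_eq_mul]
    ring
  have e2 : ((2 * Real.pi : ℝ)⁻¹) • ∫ θ in (0)..(2 * Real.pi),
      conj (F (circleMap 0 r θ)) * F (circleMap 0 r θ) =
      ((Real.circleAverage (fun z => ‖F z‖ ^ 2) 0 r : ℝ) : ℂ) := by
    rw [Real.circleAverage_def, Complex.real_smul, smul_eq_mul, Complex.ofReal_mul,
      ← intervalIntegral.integral_ofReal]
    congr 1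
    refine intervalIntegral.integral_congr fun θ _ => ?_
    rw [mul_comm, Complex.mul_conj, Complex.normSq_eq_norm_sq]
  simp only [e1, e2] at key2
  exact key2

/-! ### Power series with nonnegative coefficients and the comparison argument -/

theorem summable_natCast_mul_pow {b : ℕ → ℝ} (hb : ∀ n, 0 ≤ b n)
    (hs : ∀ t, 0 ≤ t → t < 1 → Summable fun n => b n * t ^ n) {t : ℝ} (ht : 0 ≤ t) (ht1 : t < 1) :
    Summable fun n : ℕ => (n * b n) * t ^ n := by
  obtain ⟨s, hts, hs1⟩ := exists_between ht1
  have hs0 : 0 < s := ht.trans_lt hts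
  have hsum := hs s hs0.le hs1
  have hq : ‖t / s‖ < 1 := by
    rw [Real.norm_of_nonneg (by positivity), div_lt_one hs0]
    exact hts
  have hgeom := (summable_pow_mul_geometric_of_norm_lt_one 1 hq).mul_left (∑' n, b n * s ^ n)
  refine Summable.of_nonneg_of_le (fun n => by have := hb n; positivity) (fun n => ?_) hgeom
  have h1 : b n * s ^ n ≤ ∑' n, b n * s ^ n :=
    hsum.le_tsum n fun m _ => by have := hb m; positivity
  calc (n * b n) * t ^ n = (b n * s ^ n) * (n ^ 1 * (t / s) ^ n) := by
        rw [div_pow]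
        field_simp
    _ ≤ _ := by gcongr

/-- The derivative is written through the Euler operator `t d/dt`, which multiplies coefficients by
`n` without shifting exponents, so that it can be iterated. -/
theorem hasDerivAt_tsum_pow {b : ℕ → ℝ} (hb : ∀ n, 0 ≤ b n)
    (hs : ∀ t, 0 ≤ t → t < 1 → Summable fun n => b n * t ^ n) {t : ℝ} (ht : 0 < t) (ht1 : t < 1) :
    HasDerivAt (fun t => ∑' n, b n * t ^ n) ((∑' n : ℕ, (n * b n) * t ^ n) / t) t := by
  obtain ⟨s, hts, hs1⟩ := exists_between ht1
  have hs0 : 0 < s := ht.trans hts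
  have hu := (summable_natCast_mul_pow hb hs hs0.le hs1).mul_right s⁻¹
  have key := hasDerivAt_tsum_of_isPreconnected (t := Set.Ioo 0 s) (y := t) (y₀ := t)
    (g := fun n t => b n * t ^ n) (g' := fun (n : ℕ) t => b n * (n * t ^ (n - 1))) hu
    isOpen_Ioo isPreconnected_Ioo (fun n y _ => (hasDerivAt_pow n y).const_mul (b n))
    (fun n y hy => by
      have := hb n
      have hy0 := hy.1
      rw [Real.norm_of_nonneg (by positivity)]
      rcases n with _ | n
      · simp
      · have : y ^ n ≤ s ^ n := by
          gcongr
          exact hy.2.le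
        calc b (n + 1) * ((n + 1 : ℕ) * y ^ n) ≤ b (n + 1) * ((n + 1 : ℕ) * s ^ n) := by gcongr
          _ = _ := by
            field_simp
            ring)
    ⟨ht, hts⟩ (hs t ht.le ht1) ⟨ht, hts⟩
  refine key.congr_deriv ?_
  symm
  rw [← tsum_div_const]
  refine tsum_congr fun n => ?_
  rcases n with _ | n
  · simp
  · field_simp
    rw [Nat.add_sub_cancel]
    ring

theorem alpha_nonneg (x : ℝ) : 0 ≤ alpha x := by
  have : 1 ≤ √(1 + 4 * x ^ 2) := Real.one_le_sqrt.mpr (by nlinarith [sq_nonneg x])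
  unfold alpha
  linarith

theorem alpha_mul_alpha_add_one (x : ℝ) : alpha x * (alpha x + 1) = x ^ 2 := by
  have := Real.sq_sqrt (show 0 ≤ 1 + 4 * x ^ 2 by positivity)
  unfold alpha
  linarith

/-- At `t = 1` the inequality is strict, because `x² = α (α + 1) < β (β + 1)`; continuity moves it
to some `t < 1`. For `v = (1 - t)^(-β)` one has `(t v')' = β (1 + β t) (1 - t)⁻² v`, so this is the
condition for `v` to be a supersolution. -/
theorem exists_sq_le_of_alpha_lt {x β : ℝ} (hβ : alpha x < β) :
    ∃ t, 0 < t ∧ t < 1 ∧ x ^ 2 ≤ β * (1 + β * t) := by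
  have h0 := alpha_nonneg x
  have h1 : x ^ 2 < β * (1 + β * 1) := by
    rw [← alpha_mul_alpha_add_one x]
    nlinarith
  have hc : ContinuousAt (fun t : ℝ => β * (1 + β * t)) 1 := by fun_prop
  have h2 : ∀ᶠ t in 𝓝[<] (1 : ℝ), x ^ 2 < β * (1 + β * t) :=
    (hc.eventually (lt_mem_nhds h1)).filter_mono nhdsWithin_le_nhds
  obtain ⟨t, ht, ht'⟩ := (h2.and (Ioo_mem_nhdsLT (show (0 : ℝ) < 1 by norm_num))).exists
  exact ⟨t, ht'.1, ht'.2, ht.le⟩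

theorem hasDerivAt_one_sub_rpow (γ : ℝ) {t : ℝ} (ht : t < 1) :
    HasDerivAt (fun t : ℝ => (1 - t) ^ γ) (-γ * (1 - t) ^ (γ - 1)) t := by
  have h := ((hasDerivAt_id t).const_sub 1).rpow_const (p := γ) (Or.inl (by simp; linarith))
  refine h.congr_deriv ?_
  rw [neg_one_mul, id]

/-- A differential inequality for power series with nonnegative coefficients: comparison with
`(1 - t) ^ (-β)` by means of the Wronskian. -/
theorem tsum_pow_le_of_differential_ineq {x β t₀ : ℝ} (hβ : 0 < β) (ht₀ : 0 < t₀) (ht₀1 : t₀ < 1)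
    (hx : x ^ 2 ≤ β * (1 + β * t₀)) {b : ℕ → ℝ} (hb : ∀ n, 0 ≤ b n)
    (hs : ∀ t, 0 ≤ t → t < 1 → Summable fun n => b n * t ^ n)
    (hD : ∀ t, 0 < t → t < 1 → ∑' n : ℕ, (n * (n * b n)) * t ^ n ≤
      t * (x ^ 2 / (1 - t) ^ 2 * ∑' n, b n * t ^ n)) {t : ℝ} (ht : 0 ≤ t) (ht1 : t < 1) :
    ∑' n, b n * t ^ n ≤ (1 + x ^ 2 / (1 - t₀) ^ 2 * (1 - t₀) ^ (-β)) *
      (∑' n, b n * t₀ ^ n) * (1 - t) ^ (-β) := by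
  set B : ℝ → ℝ := fun t => ∑' n, b n * t ^ n with hB
  set E : ℝ → ℝ := fun t => ∑' n : ℕ, (n * b n) * t ^ n with hE
  set D : ℝ → ℝ := fun t => ∑' n : ℕ, (n * (n * b n)) * t ^ n with hDdef
  have hb1 : ∀ n : ℕ, 0 ≤ n * b n := fun n => mul_nonneg n.cast_nonneg (hb n)
  have hs1 : ∀ t, 0 ≤ t → t < 1 → Summable fun n : ℕ => (n * b n) * t ^ n :=
    fun t h0 h1 => summable_natCast_mul_pow hb hs h0 h1
  have hs2 : ∀ t, 0 ≤ t → t < 1 → Summable fun n : ℕ => (n * (n * b n)) * t ^ n :=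
    fun t h0 h1 => summable_natCast_mul_pow hb1 hs1 h0 h1
  have hB' : ∀ t, 0 < t → t < 1 → HasDerivAt B (E t / t) t :=
    fun t h0 h1 => hasDerivAt_tsum_pow hb hs h0 h1
  have hE' : ∀ t, 0 < t → t < 1 → HasDerivAt E (D t / t) t :=
    fun t h0 h1 => hasDerivAt_tsum_pow hb1 hs1 h0 h1
  have hB0 : ∀ t, 0 ≤ t → 0 ≤ B t := fun t h0 =>
    tsum_nonneg fun n => mul_nonneg (hb n) (pow_nonneg h0 n)
  have hv1 : ∀ t : ℝ, 0 ≤ t → t < 1 → 1 ≤ (1 - t) ^ (-β) := fun t h0 h1 =>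
    Real.one_le_rpow_of_pos_of_le_one_of_nonpos (by linarith) (by linarith) (by linarith)
  -- Chosen so that `t₀ C₀` bounds the Wronskian at `t₀`: there `E ≤ D`, since `n ≤ n²`, and `hD`
  -- bounds `D`.
  set C₀ : ℝ := x ^ 2 / (1 - t₀) ^ 2 * (1 - t₀) ^ (-β) * B t₀ with hC₀
  have hC₀0 : 0 ≤ C₀ := by
    have := hv1 t₀ ht₀.le ht₀1
    have := hB0 t₀ ht₀.le
    positivity
  change B t ≤ (1 + x ^ 2 / (1 - t₀) ^ 2 * (1 - t₀) ^ (-β)) * B t₀ * (1 - t) ^ (-β)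
  rw [show (1 + x ^ 2 / (1 - t₀) ^ 2 * (1 - t₀) ^ (-β)) * B t₀ = B t₀ + C₀ by rw [hC₀]; ring]
  rcases le_total t t₀ with h | h
  · have h1 : B t ≤ B t₀ := (hs t ht ht1).tsum_le_tsum (fun n => by have := hb n; gcongr)
      (hs t₀ ht₀.le ht₀1)
    nlinarith [hv1 t ht ht1, hB0 t₀ ht₀.le]
  have hpos : ∀ s ∈ Set.Icc t₀ t, 0 < s ∧ s < 1 := fun s hs => ⟨ht₀.trans_le hs.1, hs.2.trans_lt ht1⟩
  -- With `v = (1 - s)^(-β)` this is `s (B' v - B v')`. Its derivative is `(s B')' v - B (s v')'`,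
  -- nonpositive on `[t₀, t]`.
  set W : ℝ → ℝ := fun s => E s * (1 - s) ^ (-β) - B s * (s * (β * (1 - s) ^ (-β - 1))) with hW
  have hWd : ∀ s, 0 < s → s < 1 → HasDerivAt W
      (D s / s * (1 - s) ^ (-β) - B s * (β * (1 + β * s) * (1 - s) ^ (-β - 2))) s := by
    intro s h0 h1
    have d1 := (hE' s h0 h1).mul (hasDerivAt_one_sub_rpow (-β) h1)
    have d2 := (hB' s h0 h1).mul
      ((hasDerivAt_id s).mul ((hasDerivAt_one_sub_rpow (-β - 1) h1).const_mul β))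
    refine (d1.sub d2).congr_deriv ?_
    have e1 : (1 - s) ^ (-β - 1) = (1 - s) ^ (-β - 2) * (1 - s) := by
      rw [← Real.rpow_add_one (by linarith)]
      ring_nf
    rw [show -β - 1 - 1 = -β - 2 by ring]
    simp only [id, e1, Pi.mul_apply]
    field_simp
    ring
  have hWle : ∀ s ∈ Set.Icc t₀ t, W s ≤ t₀ * C₀ := by
    have hanti : AntitoneOn W (Set.Icc t₀ t) := by
      refine antitoneOn_of_hasDerivWithinAt_nonpos (convex_Icc t₀ t)
        (fun s hs => (hWd s (hpos s hs).1 (hpos s hs).2).continuousAt.continuousWithinAt)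
        (fun s hs => (hWd s (hpos s (interior_subset hs)).1
          (hpos s (interior_subset hs)).2).hasDerivWithinAt) fun s hs => ?_
      obtain ⟨h0, h1⟩ := hpos s (interior_subset hs)
      have hts : t₀ ≤ s := (interior_subset hs).1
      have e2 : (1 - s) ^ (-β - 2) = (1 - s) ^ (-β) / (1 - s) ^ 2 := by
        rw [Real.rpow_sub (by linarith)]
        norm_num
      have h2 : D s / s ≤ x ^ 2 / (1 - s) ^ 2 * B s := by
        rw [div_le_iff₀ h0, mul_comm]
        exact hD s h0 h1
      have h3 : x ^ 2 ≤ β * (1 + β * s) := hx.trans (by gcongr)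
      have hv := hv1 s h0.le h1
      have hB0s := hB0 s h0.le
      rw [sub_nonpos, e2]
      calc D s / s * (1 - s) ^ (-β) ≤ x ^ 2 / (1 - s) ^ 2 * B s * (1 - s) ^ (-β) := by gcongr
        _ ≤ (β * (1 + β * s)) / (1 - s) ^ 2 * B s * (1 - s) ^ (-β) := by gcongr
        _ = _ := by ring
    intro s hs
    have hv := hv1 t₀ ht₀.le ht₀1
    have hE1 : E t₀ ≤ D t₀ := (hs1 t₀ ht₀.le ht₀1).tsum_le_tsum (fun n => by
      have h2 := hb1 n
      have h3 : n * b n ≤ n * (n * b n) := by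
        rcases n with _ | n
        · simp
        · exact le_mul_of_one_le_left h2 (by simp)
      gcongr) (hs2 t₀ ht₀.le ht₀1)
    have hBt := hB0 t₀ ht₀.le
    have ht₀' : 0 < 1 - t₀ := by linarith
    calc W s ≤ W t₀ := hanti ⟨le_rfl, h⟩ hs hs.1
      _ ≤ E t₀ * (1 - t₀) ^ (-β) := sub_le_self _ (by positivity)
      _ ≤ t₀ * (x ^ 2 / (1 - t₀) ^ 2 * B t₀) * (1 - t₀) ^ (-β) := by
        gcongr
        exact hE1.trans (hD t₀ ht₀ ht₀1)
      _ = t₀ * C₀ := by rw [hC₀]; ring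
  -- The quotient rule gives `(B / v)' = W / (s v²)`. As `v ≥ 1` and `s ≥ t₀`, this is at most `C₀`,
  -- so `B / v - C₀ s` decreases.
  have hRd : ∀ s, 0 < s → s < 1 → HasDerivAt (fun s => B s * (1 - s) ^ β - C₀ * s)
      (W s * ((1 - s) ^ β) ^ 2 / s - C₀) s := by
    intro s h0 h1
    have d := ((hB' s h0 h1).mul (hasDerivAt_one_sub_rpow β h1)).sub
      ((hasDerivAt_id s).const_mul C₀)
    refine d.congr_deriv ?_
    have hs0 : 0 < (1 - s) := by linarith
    have e0 : (1 - s) ^ β ≠ 0 := (Real.rpow_pos_of_pos hs0 _).ne'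
    simp only [hW, mul_one, Real.rpow_sub hs0, Real.rpow_neg hs0.le, Real.rpow_one]
    field_simp
    ring
  have hR : AntitoneOn (fun s => B s * (1 - s) ^ β - C₀ * s) (Set.Icc t₀ t) := by
    refine antitoneOn_of_hasDerivWithinAt_nonpos (convex_Icc t₀ t)
      (fun s hs => (hRd s (hpos s hs).1 (hpos s hs).2).continuousAt.continuousWithinAt)
      (fun s hs => (hRd s (hpos s (interior_subset hs)).1
        (hpos s (interior_subset hs)).2).hasDerivWithinAt) fun s hs => ?_
    obtain ⟨h0, h1⟩ := hpos s (interior_subset hs)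
    have hts : t₀ ≤ s := (interior_subset hs).1
    have hv : (1 - s) ^ β ≤ 1 := Real.rpow_le_one (by linarith) (by linarith) hβ.le
    have hv0 : 0 ≤ (1 - s) ^ β := Real.rpow_nonneg (by linarith) _
    rw [sub_nonpos, div_le_iff₀ h0]
    calc W s * ((1 - s) ^ β) ^ 2 ≤ t₀ * C₀ * ((1 - s) ^ β) ^ 2 := by
          gcongr
          exact hWle s (interior_subset hs)
      _ ≤ t₀ * C₀ * 1 := by
          gcongr
          exact pow_le_one₀ hv0 hv
      _ ≤ C₀ * s := by nlinarith
  have hfin := hR ⟨le_rfl, h⟩ ⟨h, le_rfl⟩ h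
  have hv : (1 - t₀) ^ β ≤ 1 := Real.rpow_le_one (by linarith) (by linarith) hβ.le
  have h4 : B t * (1 - t) ^ β ≤ B t₀ + C₀ := by
    have := mul_le_mul_of_nonneg_left hv (hB0 t₀ ht₀.le)
    simp only at hfin
    nlinarith
  rwa [Real.rpow_neg (by linarith), ← div_eq_mul_inv,
    le_div_iff₀ (Real.rpow_pos_of_pos (by linarith) _)]

/-! ### Integral means of nonvanishing functions with bounded logarithmic derivative -/

theorem differentiableAt_of_mem_disk {F : ℂ → ℂ} (hF : DifferentiableOn ℂ F disk) {z : ℂ}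
    (hz : z ∈ disk) : DifferentiableAt ℂ F z :=
  hF.differentiableAt (isOpen_disk.mem_nhds hz)

theorem zero_mem_disk : (0 : ℂ) ∈ disk := by simp [mem_disk_iff]

/-- A holomorphic logarithm of a nonvanishing function on the disk. -/
theorem exists_log {G : ℂ → ℂ} (hG : DifferentiableOn ℂ G disk) (h0 : ∀ z ∈ disk, G z ≠ 0) :
    ∃ L : ℂ → ℂ, (∀ z ∈ disk, HasDerivAt L (deriv G z / G z) z) ∧
      ∀ z ∈ disk, G z = Complex.exp (L z) := by
  obtain ⟨L, hL0, hL⟩ := ((hG.deriv isOpen_disk).div hG h0).isExactOn_ball.with_val_at 0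
    (Complex.log (G 0))
  refine ⟨L, hL, fun z hz => ?_⟩
  have hd : ∀ z ∈ disk, HasDerivAt (fun z => G z * Complex.exp (-L z)) 0 z := fun z hz => by
    refine ((differentiableAt_of_mem_disk hG hz).hasDerivAt.mul (hL z hz).neg.cexp).congr_deriv ?_
    have := h0 z hz
    simp only [Pi.div_apply, Pi.neg_apply]
    field_simp
    ring
  have hc : G z * Complex.exp (-L z) = G 0 * Complex.exp (-L 0) :=
    isOpen_disk.is_const_of_deriv_eq_zero (convex_ball (0 : ℂ) 1).isPreconnected
      (fun w hw => (hd w hw).differentiableAt.differentiableWithinAt)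
      (fun w hw => (hd w hw).deriv) hz zero_mem_disk
  rw [hL0, Complex.exp_neg, Complex.exp_neg, Complex.exp_log (h0 0 zero_mem_disk),
    mul_inv_cancel₀ (h0 0 zero_mem_disk)] at hc
  exact eq_of_div_eq_one (by rw [div_eq_mul_inv]; exact hc)

/-- `F` has no zeros in the disk, and `(1 - |z| ^ 2) |F' / F| ≤ Λ` there. -/
structure LogDerivBound (Λ : ℝ) (F : ℂ → ℂ) : Prop where
  differentiableOn : DifferentiableOn ℂ F disk
  ne_zero : ∀ z ∈ disk, F z ≠ 0
  bound : ∀ z ∈ disk, (1 - ‖z‖ ^ 2) * ‖deriv F z‖ ≤ Λ * ‖F z‖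

theorem one_sub_sq_norm_pos {z : ℂ} (hz : z ∈ disk) : 0 < 1 - ‖z‖ ^ 2 := by
  have := mem_disk_iff.mp hz
  nlinarith [norm_nonneg z]

theorem norm_of_circle {r : ℝ} (hr : 0 ≤ r) {z : ℂ} (hz : z ∈ Metric.sphere (0 : ℂ) |r|) :
    ‖z‖ = r := by
  rw [mem_sphere_zero_iff_norm, abs_of_nonneg hr] at hz
  exact hz

theorem integralMean_nonneg (p r : ℝ) (F : ℂ → ℂ) : 0 ≤ integralMean p r F :=
  Real.circleAverage_nonneg_of_nonneg fun _ _ => Real.rpow_nonneg (norm_nonneg _) _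

/-- Parseval turns the pointwise bound on `K'` into the differential inequality for the squared
means. `C` and `r₀` are chosen before `K`, which later yields uniformity in `ε`. -/
theorem circleAverage_sq_norm_le {x β : ℝ} (hβ : alpha x < β) :
    ∃ C r₀ : ℝ, 0 ≤ C ∧ 0 < r₀ ∧ r₀ < 1 ∧ ∀ K : ℂ → ℂ, DifferentiableOn ℂ K disk →
      (∀ z ∈ disk, (1 - ‖z‖ ^ 2) * ‖deriv K z‖ ≤ x * ‖K z‖) → ∀ r : ℝ, 0 ≤ r → r < 1 →
      Real.circleAverage (fun z => ‖K z‖ ^ 2) 0 r ≤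
        C * Real.circleAverage (fun z => ‖K z‖ ^ 2) 0 r₀ * (1 - r ^ 2) ^ (-β) := by
  obtain ⟨t₀, h0, h1, hx⟩ := exists_sq_le_of_alpha_lt hβ
  have hβ0 : 0 < β := (alpha_nonneg x).trans_lt hβ
  refine ⟨1 + x ^ 2 / (1 - t₀) ^ 2 * (1 - t₀) ^ (-β), √t₀, ?_, Real.sqrt_pos.mpr h0, ?_, ?_⟩
  · have : 0 ≤ (1 - t₀) ^ (-β) := Real.rpow_nonneg (by linarith) _
    positivity
  · rw [Real.sqrt_lt' one_pos]
    linarith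
  intro K hK hb r hr hr1
  have hP : ∀ {F : ℂ → ℂ}, DifferentiableOn ℂ F disk → ∀ t, 0 ≤ t → t < 1 →
      HasSum (fun n => ‖taylorCoeff F n‖ ^ 2 * t ^ n)
        (Real.circleAverage (fun z => ‖F z‖ ^ 2) 0 √t) := fun hF t h0 h1 => by
    have := hasSum_sq_norm_taylorCoeff hF (Real.sqrt_nonneg t)
      ((Real.sqrt_lt' one_pos).mpr (by linarith))
    simpa only [pow_mul, Real.sq_sqrt h0] using this
  have key := tsum_pow_le_of_differential_ineq hβ0 h0 h1 hx
    (b := fun n => ‖taylorCoeff K n‖ ^ 2) (fun n => by positivity)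
    (fun t h0 h1 => (hP hK t h0 h1).summable) (fun t ht ht1 => by
      -- The term `n = 0` vanishes; shifting the index leaves the Parseval series of `K'` times `t`.
      have e1 : HasSum (fun n : ℕ => (n : ℝ) * (n * ‖taylorCoeff K n‖ ^ 2) * t ^ n)
          (t * Real.circleAverage (fun z => ‖deriv K z‖ ^ 2) 0 √t) := by
        have h := (hP (hK.deriv isOpen_disk) t ht.le ht1).mul_left t
        rw [← hasSum_nat_add_iff' 1]
        simp only [Finset.range_one, Finset.sum_singleton, Nat.cast_zero, zero_mul, sub_zero]
        convert! h using 2 with n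
        rw [taylorCoeff_deriv, norm_mul, mul_pow]
        norm_cast
        push_cast
        ring
      rw [e1.tsum_eq, (hP hK t ht.le ht1).tsum_eq]
      gcongr
      have hs1 : √t < 1 := (Real.sqrt_lt' one_pos).mpr (by linarith)
      rw [← smul_eq_mul, ← Real.circleAverage_fun_smul]
      refine Real.circleAverage_mono
        (circleIntegrable_of_continuousOn_disk ((hK.deriv isOpen_disk).continuousOn.norm.pow 2)
          (Real.sqrt_nonneg t) hs1)
        (circleIntegrable_of_continuousOn_disk (F := fun z => (x ^ 2 / (1 - t) ^ 2) • ‖K z‖ ^ 2)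
          (by have := hK.continuousOn; fun_prop) (Real.sqrt_nonneg t) hs1)
        fun z hz => ?_
      have hz' := norm_of_circle (Real.sqrt_nonneg t) hz
      have hzd : z ∈ disk := by rw [mem_disk_iff, hz']; exact hs1
      have h2 := hb z hzd
      rw [hz', Real.sq_sqrt ht.le] at h2
      have h3 : 0 < 1 - t := by linarith
      rw [smul_eq_mul, div_mul_eq_mul_div, le_div_iff₀ (by positivity), ← mul_pow, ← mul_pow,
        mul_comm ‖deriv K z‖]
      gcongr) (sq_nonneg r) (by nlinarith : r ^ 2 < 1)
  rw [(hP hK (r ^ 2) (sq_nonneg r) (by nlinarith)).tsum_eq, (hP hK t₀ h0.le h1).tsum_eq,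
    Real.sqrt_sq hr] at key
  exact key

/-- Growth of the integral means of a nonvanishing function with bounded logarithmic
derivative, in terms of a single integral mean. -/
theorem LogDerivBound.integralMean_le {Λ p β : ℝ} (hβ : alpha (|p| * Λ / 2) < β) :
    ∃ C r₀ : ℝ, 0 ≤ C ∧ 0 < r₀ ∧ r₀ < 1 ∧ ∀ G : ℂ → ℂ, LogDerivBound Λ G → ∀ r : ℝ, 0 ≤ r → r < 1 →
      integralMean p r G ≤ C * integralMean p r₀ G * (1 - r) ^ (-β) := by
  obtain ⟨C, r₀, hC, h0, h1, hK⟩ := circleAverage_sq_norm_le hβ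
  refine ⟨C, r₀, hC, h0, h1, fun G hG r hr hr1 => ?_⟩
  obtain ⟨L, hL, hLG⟩ := exists_log hG.differentiableOn hG.ne_zero
  -- This exponential is a branch of `G^(p/2)`, available for every real `p` because `G` has no
  -- zeros.
  have hd : ∀ z ∈ disk, HasDerivAt (fun z => Complex.exp ((p / 2 : ℝ) * L z))
      (Complex.exp ((p / 2 : ℝ) * L z) * ((p / 2 : ℝ) * (deriv G z / G z))) z :=
    fun z hz => ((hL z hz).const_mul _).cexp
  have hKG : ∀ z ∈ disk, ‖Complex.exp ((p / 2 : ℝ) * L z)‖ ^ 2 = ‖G z‖ ^ p := fun z hz => by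
    rw [hLG z hz, Complex.norm_exp, Complex.norm_exp, ← Real.exp_mul, ← Real.exp_nat_mul,
      Complex.re_ofReal_mul]
    congr 1
    push_cast
    ring
  have key := hK _ (fun z hz => (hd z hz).differentiableAt.differentiableWithinAt)
    (fun z hz => by
      rw [(hd z hz).deriv, norm_mul, norm_mul, norm_div, Complex.norm_real, Real.norm_eq_abs,
        abs_div, abs_two]
      have hG0 : 0 < ‖G z‖ := norm_pos_iff.mpr (hG.ne_zero z hz)
      have h2 : (1 - ‖z‖ ^ 2) * (‖deriv G z‖ / ‖G z‖) ≤ Λ := by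
        rw [← mul_div_assoc, div_le_iff₀ hG0]
        exact hG.bound z hz
      calc (1 - ‖z‖ ^ 2) * (‖Complex.exp ((p / 2 : ℝ) * L z)‖ *
            (|p| / 2 * (‖deriv G z‖ / ‖G z‖)))
          = |p| / 2 * ((1 - ‖z‖ ^ 2) * (‖deriv G z‖ / ‖G z‖)) *
            ‖Complex.exp ((p / 2 : ℝ) * L z)‖ := by ring
        _ ≤ |p| / 2 * Λ * ‖Complex.exp ((p / 2 : ℝ) * L z)‖ := by gcongr
        _ = _ := by ring) r hr hr1
  have e : ∀ s, 0 ≤ s → s < 1 →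
      Real.circleAverage (fun z => ‖Complex.exp ((p / 2 : ℝ) * L z)‖ ^ 2) 0 s =
        integralMean p s G := fun s hs hs1 =>
    Real.circleAverage_congr_sphere fun z hz =>
      hKG z (by rw [mem_disk_iff, norm_of_circle hs hz]; exact hs1)
  rw [e r hr hr1, e r₀ h0.le h1] at key
  refine key.trans ?_
  have hI := integralMean_nonneg p r₀ G
  have hβ0 : 0 ≤ β := ((alpha_nonneg _).trans_lt hβ).le
  have h3 : (1 - r ^ 2) ^ (-β) ≤ (1 - r) ^ (-β) :=
    Real.rpow_le_rpow_of_nonpos (by linarith) (by nlinarith) (by linarith)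
  gcongr

/-! ### Disk automorphisms and the Schwarz–Pick inequality -/

theorem norm_add_conj_mul_sq (a b e : ℂ) :
    ‖a + e * b‖ ^ 2 - ‖conj b + e * conj a‖ ^ 2 = (1 - ‖e‖ ^ 2) * (‖a‖ ^ 2 - ‖b‖ ^ 2) := by
  simp only [← Complex.normSq_eq_norm_sq, Complex.normSq_apply, Complex.add_re, Complex.add_im,
    Complex.mul_re, Complex.mul_im, Complex.conj_re, Complex.conj_im]
  ring

theorem one_add_conj_mul_ne_zero {a u : ℂ} (ha : a ∈ disk) (hu : u ∈ disk) :
    1 + conj a * u ≠ 0 := fun h => by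
  have h1 : ‖conj a * u‖ = 1 := by
    rw [eq_neg_of_add_eq_zero_right h, norm_neg, norm_one]
  rw [norm_mul, RCLike.norm_conj] at h1
  have h2 := mem_disk_iff.mp ha
  have h3 := mem_disk_iff.mp hu
  nlinarith [norm_nonneg a, norm_nonneg u]

theorem mobius_mem_disk {a u : ℂ} (ha : a ∈ disk) (hu : u ∈ disk) :
    (u + a) / (1 + conj a * u) ∈ disk := by
  have h0 := norm_pos_iff.mpr (one_add_conj_mul_ne_zero ha hu)
  rw [mem_disk_iff, norm_div, div_lt_one h0]
  have h1 := norm_add_conj_mul_sq 1 u (conj a)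
  have h2 : ‖conj u + conj a * conj 1‖ = ‖u + a‖ := by
    rw [map_one, mul_one, ← map_add, RCLike.norm_conj]
  rw [h2, RCLike.norm_conj, norm_one, one_pow] at h1
  have h3 := mul_pos (one_sub_sq_norm_pos ha) (one_sub_sq_norm_pos hu)
  exact lt_of_pow_lt_pow_left₀ 2 h0.le (by linarith)

theorem hasDerivAt_mobius {a u : ℂ} (ha : a ∈ disk) (hu : u ∈ disk) :
    HasDerivAt (fun u => (u + a) / (1 + conj a * u))
      ((1 - (‖a‖ : ℂ) ^ 2) / (1 + conj a * u) ^ 2) u := by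
  have h0 := one_add_conj_mul_ne_zero ha hu
  refine (((hasDerivAt_id u).add_const a).div (((hasDerivAt_id u).const_mul (conj a)).const_add 1)
    h0).congr_deriv ?_
  rw [← Complex.mul_conj']
  simp only [id]
  congr 1
  ring

/-- The Schwarz–Pick inequality. -/
theorem schwarz_pick {w : ℂ → ℂ} (hw : DifferentiableOn ℂ w disk) (hmaps : Set.MapsTo w disk disk)
    {z : ℂ} (hz : z ∈ disk) : (1 - ‖z‖ ^ 2) * ‖deriv w z‖ ≤ 1 - ‖w z‖ ^ 2 := by
  have hc : -w z ∈ disk := by simpa [mem_disk_iff] using hmaps hz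
  -- Automorphisms on both sides move `z` and `w z` to the origin, so that the Schwarz lemma bounds
  -- `T' 0`.
  set T : ℂ → ℂ := fun u => (w ((u + z) / (1 + conj z * u)) + -w z) /
    (1 + conj (-w z) * w ((u + z) / (1 + conj z * u))) with hT
  have hd : ∀ u ∈ disk, HasDerivAt T
      ((1 - (‖-w z‖ : ℂ) ^ 2) / (1 + conj (-w z) * w ((u + z) / (1 + conj z * u))) ^ 2 *
        (deriv w ((u + z) / (1 + conj z * u)) *
          ((1 - (‖z‖ : ℂ) ^ 2) / (1 + conj z * u) ^ 2))) u := fun u hu => by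
    have hm := mobius_mem_disk hz hu
    exact (hasDerivAt_mobius hc (hmaps hm)).comp u
      ((differentiableAt_of_mem_disk hw hm).hasDerivAt.comp u (hasDerivAt_mobius hz hu))
  have hT0 : T 0 = 0 := by simp [hT]
  have h1 : ‖deriv T 0‖ ≤ 1 := by
    refine Complex.norm_deriv_le_one_of_mapsTo_ball (R := 1)
      (fun u hu => (hd u hu).differentiableAt.differentiableWithinAt) (fun u hu => ?_) one_pos
    rw [hT0]
    exact Metric.ball_subset_closedBall (mobius_mem_disk hc (hmaps (mobius_mem_disk hz hu)))
  have hwz := one_sub_sq_norm_pos (hmaps hz)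
  rw [(hd 0 zero_mem_disk).deriv] at h1
  have e : (1 - (‖-w z‖ : ℂ) ^ 2) / (1 + conj (-w z) * w ((0 + z) / (1 + conj z * 0))) ^ 2 *
        (deriv w ((0 + z) / (1 + conj z * 0)) * ((1 - (‖z‖ : ℂ) ^ 2) / (1 + conj z * 0) ^ 2)) =
      ((1 - ‖z‖ ^ 2 : ℝ) : ℂ) * deriv w z / ((1 - ‖w z‖ ^ 2 : ℝ) : ℂ) := by
    have h2 : ((1 - ‖w z‖ ^ 2 : ℝ) : ℂ) ≠ 0 := Complex.ofReal_ne_zero.mpr hwz.ne'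
    have h3 : (1 + conj (-w z) * w z) = ((1 - ‖w z‖ ^ 2 : ℝ) : ℂ) := by
      rw [map_neg, neg_mul, Complex.conj_mul']
      push_cast
      ring
    simp only [mul_zero, add_zero, zero_add, div_one, one_pow, norm_neg, h3]
    rw [show (1 - (‖w z‖ : ℂ) ^ 2) = ((1 - ‖w z‖ ^ 2 : ℝ) : ℂ) by push_cast; ring]
    field_simp
    push_cast
    ring
  rw [e, norm_div, norm_mul, Complex.norm_real, Complex.norm_real, Real.norm_of_nonneg hwz.le,
    Real.norm_of_nonneg (one_sub_sq_norm_pos hz).le, div_le_one hwz] at h1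
  exact h1

/-! ### The logarithmic derivative of `h' + ε g'` and its means -/

namespace IsInBH

variable {lam : ℝ} {f h g : ℂ → ℂ}

theorem norm_deriv_lt (hf : IsInBH lam f h g) {z : ℂ} (hz : z ∈ disk) :
    ‖deriv g z‖ < ‖deriv h z‖ := by
  have := hf.sense_preserving z hz
  exact lt_of_pow_lt_pow_left₀ 2 (norm_nonneg _) (by rw [jacobian] at this; linarith)

theorem norm_preSchwarzian_le (hlam : 0 ≤ lam) (hf : IsInBH lam f h g) {z : ℂ} (hz : z ∈ disk) :
    (1 - ‖z‖ ^ 2) * ‖preSchwarzian h g z‖ ≤ lam := by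
  rw [← ENNReal.ofReal_le_ofReal_iff hlam]
  exact (le_iSup₂ (f := fun z (_ : z ∈ disk) =>
    ENNReal.ofReal ((1 - ‖z‖ ^ 2) * ‖preSchwarzian h g z‖)) z hz).trans hf.norm_le

/-- The dilatation of a sense-preserving harmonic mapping satisfies the Schwarz–Pick inequality. -/
theorem norm_wronskian_le (hf : IsInBH lam f h g) {z : ℂ} (hz : z ∈ disk) :
    (1 - ‖z‖ ^ 2) * ‖deriv (deriv g) z * deriv h z - deriv g z * deriv (deriv h) z‖ ≤
      jacobian h g z := by
  have h0 : ∀ z ∈ disk, deriv h z ≠ 0 := fun z hz =>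
    norm_pos_iff.mp ((norm_nonneg _).trans_lt (hf.norm_deriv_lt hz))
  have dh := hf.analytic_h.deriv isOpen_disk
  have dg := hf.analytic_g.deriv isOpen_disk
  -- Applied to the dilatation `g'/h'`; multiplying by `|h'|²` turns the right-hand side into the
  -- Jacobian.
  have key := schwarz_pick (dg.div dh h0) (fun z hz => by
    rw [mem_disk_iff, Pi.div_apply, norm_div, div_lt_one (norm_pos_iff.mpr (h0 z hz))]
    exact hf.norm_deriv_lt hz) hz
  have hp := norm_pos_iff.mpr (h0 z hz)
  rw [((differentiableAt_of_mem_disk dg hz).hasDerivAt.div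
    (differentiableAt_of_mem_disk dh hz).hasDerivAt (h0 z hz)).deriv, Pi.div_apply, norm_div,
    norm_div, norm_pow, div_pow, ← mul_div_assoc, div_le_iff₀ (by positivity)] at key
  refine key.trans_eq ?_
  rw [jacobian]
  field_simp

theorem logDerivBound (hlam : 0 ≤ lam) (hf : IsInBH lam f h g) {ε : ℂ} (hε : ‖ε‖ ≤ 1) :
    LogDerivBound (lam + 1) (fun z => deriv h z + ε * deriv g z) := by
  have dh := hf.analytic_h.deriv isOpen_disk
  have dg := hf.analytic_g.deriv isOpen_disk
  refine ⟨dh.add (dg.const_mul ε), fun z hz h0 => ?_, fun z hz => ?_⟩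
  · have h1 := hf.norm_deriv_lt hz
    rw [eq_neg_of_add_eq_zero_left h0, norm_neg, norm_mul] at h1
    nlinarith [norm_nonneg (deriv g z)]
  · have hd : HasDerivAt (fun z => deriv h z + ε * deriv g z)
        (deriv (deriv h) z + ε * deriv (deriv g) z) z :=
      (differentiableAt_of_mem_disk dh hz).hasDerivAt.add
        ((differentiableAt_of_mem_disk dg hz).hasDerivAt.const_mul ε)
    rw [hd.deriv]
    have hJ := hf.sense_preserving z hz
    have hP := hf.norm_preSchwarzian_le hlam hz
    have hW := hf.norm_wronskian_le hz
    have hz1 := one_sub_sq_norm_pos hz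
    have hN : ‖conj (deriv g z) + ε * conj (deriv h z)‖ ≤ ‖deriv h z + ε * deriv g z‖ := by
      have h1 := norm_add_conj_mul_sq (deriv h z) (deriv g z) ε
      have h2 : 0 ≤ (1 - ‖ε‖ ^ 2) * (‖deriv h z‖ ^ 2 - ‖deriv g z‖ ^ 2) :=
        mul_nonneg (by nlinarith [norm_nonneg ε]) hJ.le
      exact le_of_pow_le_pow_left₀ two_ne_zero (norm_nonneg _) (by linarith)
    rw [preSchwarzian, norm_div, Complex.norm_real, Real.norm_of_nonneg hJ.le, ← mul_div_assoc,
      div_le_iff₀ hJ] at hP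
    -- The key identity: it separates the numerator of `P_f`, controlled by `lam`, from the
    -- Wronskian, controlled by Schwarz–Pick.
    have hid : (deriv (deriv h) z + ε * deriv (deriv g) z) * (jacobian h g z : ℂ) =
        (deriv h z + ε * deriv g z) *
          (deriv (deriv h) z * conj (deriv h z) - deriv (deriv g) z * conj (deriv g z)) +
        (deriv (deriv g) z * deriv h z - deriv g z * deriv (deriv h) z) *
          (conj (deriv g z) + ε * conj (deriv h z)) := by
      rw [jacobian]
      push_cast
      rw [← Complex.mul_conj', ← Complex.mul_conj']
      ring
    refine le_of_mul_le_mul_right ?_ hJ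
    calc (1 - ‖z‖ ^ 2) * ‖deriv (deriv h) z + ε * deriv (deriv g) z‖ * jacobian h g z
        = (1 - ‖z‖ ^ 2) *
          ‖(deriv (deriv h) z + ε * deriv (deriv g) z) * (jacobian h g z : ℂ)‖ := by
          rw [norm_mul, Complex.norm_real, Real.norm_of_nonneg hJ.le, mul_assoc]
      _ ≤ (1 - ‖z‖ ^ 2) * (‖deriv h z + ε * deriv g z‖ *
          ‖deriv (deriv h) z * conj (deriv h z) - deriv (deriv g) z * conj (deriv g z)‖ +
          ‖deriv (deriv g) z * deriv h z - deriv g z * deriv (deriv h) z‖ *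
            ‖conj (deriv g z) + ε * conj (deriv h z)‖) := by
          rw [hid, ← norm_mul, ← norm_mul]
          gcongr
          exact norm_add_le _ _
      _ = ‖deriv h z + ε * deriv g z‖ * ((1 - ‖z‖ ^ 2) *
          ‖deriv (deriv h) z * conj (deriv h z) - deriv (deriv g) z * conj (deriv g z)‖) +
          ((1 - ‖z‖ ^ 2) * ‖deriv (deriv g) z * deriv h z - deriv g z * deriv (deriv h) z‖) *
            ‖conj (deriv g z) + ε * conj (deriv h z)‖ := by ring
      _ ≤ ‖deriv h z + ε * deriv g z‖ * (lam * jacobian h g z) +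
          jacobian h g z * ‖deriv h z + ε * deriv g z‖ := by gcongr
      _ = _ := by ring

/-- The integral means of `h' + ε g'` are bounded uniformly in `ε` on the closed unit disk. -/
theorem exists_integralMean_le (hlam : 0 ≤ lam) (hf : IsInBH lam f h g) {p β : ℝ}
    (hβ : alpha (|p| * (lam + 1) / 2) < β) :
    ∃ C : ℝ, ∀ r : ℝ, 0 ≤ r → r < 1 → ∀ ε : ℂ, ‖ε‖ ≤ 1 →
      integralMean p r (fun z => deriv h z + ε * deriv g z) ≤ C * (1 - r) ^ (-β) := by
  obtain ⟨C, r₀, hC, h0, h1, hG⟩ := LogDerivBound.integralMean_le hβ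
  -- Joint continuity on a compact product bounds the mean at `r₀` for all `ε` at once. Nonvanishing
  -- is needed since `p` may be negative.
  have hcont : ContinuousOn (fun q : ℂ × ℂ => ‖deriv h q.1 + q.2 * deriv g q.1‖ ^ p)
      (Metric.closedBall 0 r₀ ×ˢ Metric.closedBall 0 1) := by
    have ch : ContinuousOn (fun q : ℂ × ℂ => deriv h q.1)
        (Metric.closedBall 0 r₀ ×ˢ Metric.closedBall 0 1) :=
      (hf.analytic_h.deriv isOpen_disk).continuousOn.comp continuousOn_fst
        fun q hq => closedBall_subset_disk h1 hq.1
    have cg : ContinuousOn (fun q : ℂ × ℂ => deriv g q.1)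
        (Metric.closedBall 0 r₀ ×ˢ Metric.closedBall 0 1) :=
      (hf.analytic_g.deriv isOpen_disk).continuousOn.comp continuousOn_fst
        fun q hq => closedBall_subset_disk h1 hq.1
    refine (ch.add (continuousOn_snd.mul cg)).norm.rpow_const fun q hq => Or.inl ?_
    exact norm_ne_zero_iff.mpr ((hf.logDerivBound hlam (mem_closedBall_zero_iff.mp hq.2)).ne_zero _
      (closedBall_subset_disk h1 hq.1))
  obtain ⟨M, hM⟩ := ((isCompact_closedBall (0 : ℂ) r₀).prod
    (isCompact_closedBall (0 : ℂ) 1)).exists_bound_of_continuousOn hcont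
  refine ⟨C * M, fun r hr hr1 ε hε => ?_⟩
  have hL := hf.logDerivBound hlam hε
  refine (hG _ hL r hr hr1).trans ?_
  have : integralMean p r₀ (fun z => deriv h z + ε * deriv g z) ≤ M := by
    refine Real.circleAverage_mono_on_of_le_circle
      (circleIntegrable_of_continuousOn_disk (hL.differentiableOn.continuousOn.norm.rpow_const
        fun z hz => Or.inl (norm_ne_zero_iff.mpr (hL.ne_zero z hz))) h0.le h1) fun z hz => ?_
    have := hM (z, ε) ⟨mem_closedBall_zero_iff.mpr (norm_of_circle h0.le hz).le,
      mem_closedBall_zero_iff.mpr hε⟩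
    exact (le_abs_self _).trans this
  have : 0 ≤ (1 - r) ^ (-β) := Real.rpow_nonneg (by linarith) _
  gcongr

end IsInBH

/-! ### Coefficient estimates -/

theorem norm_taylorCoeff_mul_pow_le {F : ℂ → ℂ} (hF : DifferentiableOn ℂ F disk) {r : ℝ}
    (hr : 0 < r) (hr1 : r < 1) (n : ℕ) :
    ‖taylorCoeff F n‖ * r ^ n ≤ Real.circleAverage (fun z => ‖F z‖) 0 r := by
  have h1 := congrArg norm (circleAverage_conj_pow_mul hF hr.le hr1 n)
  have h2 : ‖Real.circleAverage (fun z => conj z ^ n * F z) 0 r‖ ≤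
      r ^ n * Real.circleAverage (fun z => ‖F z‖) 0 r := by
    rw [← smul_eq_mul, ← Real.circleAverage_fun_smul, Real.circleAverage_def,
      Real.circleAverage_def, norm_smul, Real.norm_of_nonneg (by positivity), smul_eq_mul]
    gcongr
    refine (intervalIntegral.norm_integral_le_integral_norm (by positivity)).trans_eq
      (intervalIntegral.integral_congr fun θ _ => ?_)
    simp only [norm_mul, norm_pow, RCLike.norm_conj, norm_circleMap_zero, abs_of_pos hr,
      smul_eq_mul]
  rw [h1, norm_mul, norm_pow, Complex.norm_real, Real.norm_of_nonneg hr.le, two_mul, pow_add,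
    mul_assoc] at h2
  rw [mul_comm]
  exact le_of_mul_le_mul_left h2 (by positivity)

namespace IsInBH

variable {lam : ℝ} {f h g : ℂ → ℂ}

theorem exists_integralMean_deriv_le (hlam : 0 ≤ lam) (hf : IsInBH lam f h g) {p β : ℝ}
    (hβ : alpha (|p| * (lam + 1) / 2) < β) :
    ∃ C : ℝ, 0 ≤ C ∧ ∀ r : ℝ, 0 ≤ r → r < 1 →
      integralMean p r (deriv h) ≤ C * (1 - r) ^ (-β) := by
  obtain ⟨C, hC⟩ := hf.exists_integralMean_le hlam hβ
  have h0 : ∀ r : ℝ, 0 ≤ r → r < 1 → integralMean p r (deriv h) ≤ C * (1 - r) ^ (-β) :=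
    fun r hr hr1 => by simpa using hC r hr hr1 0 (by simp)
  refine ⟨C, ?_, h0⟩
  simpa using (integralMean_nonneg p 0 (deriv h)).trans (h0 0 le_rfl one_pos)

theorem taylorCoeff_isBigO (hlam : 0 ≤ lam) (hf : IsInBH lam f h g) {β : ℝ}
    (hβ : alpha ((lam + 1) / 2) < β) :
    (fun n : ℕ => ‖taylorCoeff h n‖ + ‖taylorCoeff g n‖) =O[atTop]
      (fun n : ℕ => (n : ℝ) ^ (β - 1)) := by
  obtain ⟨C, hC0, hC⟩ := hf.exists_integralMean_deriv_le hlam (p := 1) (β := β) (by simpa using hβ)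
  have dh := hf.analytic_h.deriv isOpen_disk
  have dg := hf.analytic_g.deriv isOpen_disk
  refine IsBigO.of_bound (2 * (Real.exp 1 * C)) ?_
  filter_upwards [eventually_ge_atTop 2] with n hn
  obtain ⟨m, rfl⟩ : ∃ m, n = m + 1 := ⟨n - 1, by omega⟩
  have hm : (0 : ℝ) < m := by exact_mod_cast (by omega : 0 < m)
  -- That is `r = 1 - 1/n` with `n = m + 1`: then `r^m ≥ 1/e`, while `(1 - r)^(-β) = n^β`.
  set r : ℝ := m / (m + 1) with hr
  have hr0 : 0 < r := by positivity
  have hr1 : r < 1 := by rw [hr, div_lt_one (by positivity)]; linarith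
  have h1r : 1 - r = ((m : ℝ) + 1)⁻¹ := by rw [hr]; field_simp; ring
  have hpow : 1 ≤ Real.exp 1 * r ^ m := by
    have h1 : r⁻¹ ≤ Real.exp (1 / m) := by
      refine le_trans (le_of_eq ?_) (Real.add_one_le_exp _)
      rw [hr]
      field_simp
      ring
    have h2 : (r⁻¹) ^ m ≤ Real.exp 1 := by
      calc (r⁻¹) ^ m ≤ (Real.exp (1 / m)) ^ m := by gcongr
        _ = Real.exp 1 := by rw [← Real.exp_nat_mul]; congr 1; field_simp
    rw [inv_pow, inv_le_iff_one_le_mul₀ (by positivity)] at h2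
    exact h2
  have hmean : Real.circleAverage (fun z => ‖deriv h z‖) 0 r ≤ C * ((m : ℝ) + 1) ^ β := by
    have := hC r hr0.le hr1
    simp only [integralMean, Real.rpow_one] at this
    rwa [h1r, Real.inv_rpow (by positivity), Real.rpow_neg (by positivity), inv_inv] at this
  -- Covers `h` and `g` together, since `|g'| < |h'|`. Passing from the derivative's coefficient of
  -- index `m` divides by `n`, hence the exponent `β - 1`.
  have hcoef : ∀ F : ℂ → ℂ, DifferentiableOn ℂ (deriv F) disk →
      (∀ z ∈ disk, ‖deriv F z‖ ≤ ‖deriv h z‖) →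
      ‖taylorCoeff F (m + 1)‖ ≤ Real.exp 1 * C * ((m : ℝ) + 1) ^ (β - 1) := by
    intro F dF hle
    have h1 := norm_taylorCoeff_mul_pow_le dF hr0 hr1 m
    have h2 : Real.circleAverage (fun z => ‖deriv F z‖) 0 r ≤
        Real.circleAverage (fun z => ‖deriv h z‖) 0 r :=
      Real.circleAverage_mono (circleIntegrable_of_continuousOn_disk dF.continuousOn.norm hr0.le hr1)
        (circleIntegrable_of_continuousOn_disk dh.continuousOn.norm hr0.le hr1)
        fun z hz => hle z (by rw [mem_disk_iff, norm_of_circle hr0.le hz]; exact hr1)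
    have h3 := (h1.trans h2).trans hmean
    have hnorm : ‖taylorCoeff (deriv F) m‖ = ((m : ℝ) + 1) * ‖taylorCoeff F (m + 1)‖ := by
      rw [taylorCoeff_deriv, norm_mul]
      norm_cast
    rw [Real.rpow_sub_one (by positivity), ← mul_div_assoc, le_div_iff₀ (by positivity),
      mul_comm _ ((m : ℝ) + 1), ← hnorm]
    calc ‖taylorCoeff (deriv F) m‖ ≤ ‖taylorCoeff (deriv F) m‖ * (Real.exp 1 * r ^ m) :=
          le_mul_of_one_le_right (norm_nonneg _) hpow
      _ = Real.exp 1 * (‖taylorCoeff (deriv F) m‖ * r ^ m) := by ring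
      _ ≤ Real.exp 1 * (C * ((m : ℝ) + 1) ^ β) := by gcongr
      _ = _ := by ring
  have hh := hcoef h dh fun z _ => le_rfl
  have hg := hcoef g dg fun z hz => (hf.norm_deriv_lt hz).le
  rw [Real.norm_of_nonneg (by positivity), Real.norm_of_nonneg (by positivity)]
  push_cast
  linarith

end IsInBH

/-! ### Integral means of `f` by dyadic decomposition of radii -/

/-- The mean value inequality along a radius. -/
theorem norm_radial_sub_le {F : ℂ → ℂ} {F' : ℂ → ℂ} (hF : ∀ z ∈ disk, HasDerivAt F (F' z) z)
    {u : ℂ} (hu : ‖u‖ = 1) {s ρ M : ℝ} (hs : 0 ≤ s) (hsρ : s ≤ ρ) (hρ : ρ < 1)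
    (hM : ∀ σ ∈ Set.Icc s ρ, ‖F' (σ * u)‖ ≤ M) : ‖F (ρ * u) - F (s * u)‖ ≤ M * (ρ - s) := by
  have hmem : ∀ σ ∈ Set.Icc s ρ, (σ * u : ℂ) ∈ disk := fun σ hσ => by
    rw [mem_disk_iff, norm_mul, hu, mul_one, Complex.norm_real,
      Real.norm_of_nonneg (hs.trans hσ.1)]
    exact hσ.2.trans_lt hρ
  refine norm_image_sub_le_of_norm_deriv_le_segment' (f := fun σ : ℝ => F (σ * u))
    (f' := fun σ : ℝ => F' (σ * u) * (1 * u)) (fun σ hσ => ?_) (fun σ hσ => ?_) ρ ⟨hsρ, le_rfl⟩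
  · have h1 : HasDerivAt (fun σ : ℝ => (σ : ℂ) * u) (1 * u) σ :=
      (Complex.ofRealCLM.hasDerivAt (x := σ)).mul_const u
    exact ((hF _ (hmem σ hσ)).comp σ h1).hasDerivWithinAt
  · rw [one_mul, norm_mul, hu, mul_one]
    exact hM σ ⟨hσ.1, hσ.2.le⟩

/-- A function with bounded logarithmic derivative is essentially constant on hyperbolically short
radial segments. -/
theorem LogDerivBound.norm_radial_le {Λ : ℝ} (hΛ : 0 ≤ Λ) {G : ℂ → ℂ} (hG : LogDerivBound Λ G)
    {u : ℂ} (hu : ‖u‖ = 1) {s ρ : ℝ} (hs : 0 ≤ s) (hs1 : s < 1) (hsρ : s ≤ ρ)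
    (hρ : ρ - s ≤ (1 - s) / 2) : ‖G (ρ * u)‖ ≤ Real.exp Λ * ‖G (s * u)‖ := by
  have hnorm : ∀ σ : ℝ, 0 ≤ σ → ‖(σ * u : ℂ)‖ = σ := fun σ hσ => by
    rw [norm_mul, hu, mul_one, Complex.norm_real, Real.norm_of_nonneg hσ]
  have hmem : ∀ σ ∈ Set.Icc s ρ, (σ * u : ℂ) ∈ disk := fun σ hσ => by
    rw [mem_disk_iff, hnorm σ (hs.trans hσ.1)]
    linarith [hσ.2]
  obtain ⟨L, hL, hLG⟩ := exists_log hG.differentiableOn hG.ne_zero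
  have hd : 0 < (1 - s) / 2 := by linarith
  have h1 : ‖L (ρ * u) - L (s * u)‖ ≤ Λ / ((1 - s) / 2) * (ρ - s) := by
    refine norm_radial_sub_le hL hu hs hsρ (by linarith) fun σ hσ => ?_
    have hσd := hmem σ hσ
    have hb := hG.bound _ hσd
    rw [hnorm σ (hs.trans hσ.1)] at hb
    rw [norm_div, div_le_iff₀ (norm_pos_iff.mpr (hG.ne_zero _ hσd)), div_mul_eq_mul_div,
      le_div_iff₀ hd]
    refine le_trans ?_ hb
    rw [mul_comm]
    gcongr
    have := hσ.1
    have := hσ.2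
    nlinarith
  have h2 : ‖L (ρ * u) - L (s * u)‖ ≤ Λ := by
    refine h1.trans ?_
    calc Λ / ((1 - s) / 2) * (ρ - s) ≤ Λ / ((1 - s) / 2) * ((1 - s) / 2) := by gcongr
      _ = Λ := div_mul_cancel₀ _ hd.ne'
  rw [hLG _ (hmem ρ ⟨hsρ, le_rfl⟩), hLG _ (hmem s ⟨le_rfl, hsρ⟩), Complex.norm_exp,
    Complex.norm_exp, ← Real.exp_add, Real.exp_le_exp]
  have h3 := (Complex.re_le_norm (L (ρ * u) - L (s * u))).trans h2
  rw [Complex.sub_re] at h3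
  linarith

/-- A weighted power inequality, valid for all positive exponents. -/
theorem rpow_sum_le_weighted {ι : Type*} (s : Finset ι) {x w : ι → ℝ} (hx : ∀ i ∈ s, 0 ≤ x i)
    (hw : ∀ i ∈ s, 0 < w i) {p : ℝ} (hp : 0 < p) :
    (∑ i ∈ s, x i) ^ p ≤ (∑ i ∈ s, w i) ^ p * ∑ i ∈ s, (x i / w i) ^ p := by
  set S := ∑ i ∈ s, (x i / w i) ^ p with hS
  have hnn : ∀ i ∈ s, 0 ≤ (x i / w i) ^ p := fun i hi =>
    Real.rpow_nonneg (div_nonneg (hx i hi) (hw i hi).le) _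
  have hS0 : 0 ≤ S := Finset.sum_nonneg hnn
  -- Only the bound of a maximum by an `ℓ^p` sum is used, not convexity, so `p < 1` is allowed.
  have h1 : ∀ i ∈ s, x i ≤ w i * S ^ p⁻¹ := fun i hi => by
    rw [mul_comm, ← div_le_iff₀ (hw i hi)]
    rw [Real.le_rpow_inv_iff_of_pos (div_nonneg (hx i hi) (hw i hi).le) hS0 hp]
    exact Finset.single_le_sum hnn hi
  have h2 : ∑ i ∈ s, x i ≤ (∑ i ∈ s, w i) * S ^ p⁻¹ := by
    rw [Finset.sum_mul]
    exact Finset.sum_le_sum h1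
  calc (∑ i ∈ s, x i) ^ p ≤ ((∑ i ∈ s, w i) * S ^ p⁻¹) ^ p := by
        gcongr
        exact Finset.sum_nonneg hx
    _ = _ := by
      rw [Real.mul_rpow (Finset.sum_nonneg fun i hi => (hw i hi).le) (Real.rpow_nonneg hS0 _),
        Real.rpow_inv_rpow hS0 hp.ne']

theorem exists_geom_sum_le {y : ℝ} (hy : 0 < y) (hy1 : y ≠ 1) :
    ∃ K : ℝ, 0 ≤ K ∧ ∀ N : ℕ, ∑ k ∈ Finset.range (N + 1), y ^ k ≤ K * (max 1 y) ^ N := by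
  rcases lt_or_gt_of_ne hy1 with h | h
  · refine ⟨(1 - y)⁻¹, inv_nonneg.mpr (by linarith), fun N => ?_⟩
    rw [max_eq_left h.le, one_pow, mul_one, ← tsum_geometric_of_lt_one hy.le h]
    exact (summable_geometric_of_lt_one hy.le h).sum_le_tsum _ fun k _ => by positivity
  · have h0 : 0 < y - 1 := by linarith
    refine ⟨y / (y - 1), by positivity, fun N => ?_⟩
    rw [max_eq_right h.le, geom_sum_eq hy1, div_mul_eq_mul_div, ← pow_succ']
    gcongr
    linarith

namespace IsInBH

variable {lam : ℝ} {f h g : ℂ → ℂ}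

theorem logDerivBound_deriv (hlam : 0 ≤ lam) (hf : IsInBH lam f h g) :
    LogDerivBound (lam + 1) (deriv h) := by
  simpa using hf.logDerivBound hlam (ε := 0) (by simp)

theorem map_zero (hf : IsInBH lam f h g) : f 0 = 0 := by
  rw [hf.eq_add_conj 0 zero_mem_disk, hf.h_zero, hf.g_zero, _root_.map_zero, add_zero]

theorem continuousOn (hf : IsInBH lam f h g) : ContinuousOn f disk :=
  (hf.analytic_h.continuousOn.add
    (Complex.continuous_conj.comp_continuousOn hf.analytic_g.continuousOn)).congr hf.eq_add_conj

/-- On such a short segment `|g'| < |h'|`, and `|h'|` is at most `e^(λ+1)` times its initial value.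
The factor 2 from adding `h` and `g` cancels the half in the segment's length. -/
theorem norm_radial_sub_le (hlam : 0 ≤ lam) (hf : IsInBH lam f h g) {u : ℂ} (hu : ‖u‖ = 1)
    {s ρ : ℝ} (hs : 0 ≤ s) (hs1 : s < 1) (hsρ : s ≤ ρ) (hρ : ρ - s ≤ (1 - s) / 2) :
    ‖f (ρ * u) - f (s * u)‖ ≤ Real.exp (lam + 1) * ‖deriv h (s * u)‖ * (1 - s) := by
  have hρ1 : ρ < 1 := by linarith
  have hmem : ∀ σ ∈ Set.Icc s ρ, (σ * u : ℂ) ∈ disk := fun σ hσ => by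
    rw [mem_disk_iff, norm_mul, hu, mul_one, Complex.norm_real,
      Real.norm_of_nonneg (hs.trans hσ.1)]
    exact hσ.2.trans_lt hρ1
  have hM : ∀ σ ∈ Set.Icc s ρ,
      ‖deriv h (σ * u)‖ ≤ Real.exp (lam + 1) * ‖deriv h (s * u)‖ := fun σ hσ =>
    (hf.logDerivBound_deriv hlam).norm_radial_le (by linarith) hu hs hs1 hσ.1
      (by linarith [hσ.2])
  have h1 := HarmonicDisk.norm_radial_sub_le
    (fun z hz => (differentiableAt_of_mem_disk hf.analytic_h hz).hasDerivAt) hu hs hsρ hρ1 hM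
  have h2 := HarmonicDisk.norm_radial_sub_le
    (fun z hz => (differentiableAt_of_mem_disk hf.analytic_g hz).hasDerivAt) hu hs hsρ hρ1
    fun σ hσ => (hf.norm_deriv_lt (hmem σ hσ)).le.trans (hM σ hσ)
  have e : f (ρ * u) - f (s * u) =
      (h (ρ * u) - h (s * u)) + conj (g (ρ * u) - g (s * u)) := by
    rw [hf.eq_add_conj _ (hmem ρ ⟨hsρ, le_rfl⟩), hf.eq_add_conj _ (hmem s ⟨le_rfl, hsρ⟩), map_sub]
    ring
  rw [e]
  refine (norm_add_le _ _).trans ?_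
  rw [RCLike.norm_conj]
  calc _ ≤ 2 * (Real.exp (lam + 1) * ‖deriv h (s * u)‖ * (ρ - s)) := by linarith
    _ ≤ 2 * (Real.exp (lam + 1) * ‖deriv h (s * u)‖ * ((1 - s) / 2)) := by gcongr
    _ = _ := by ring

/-- Dyadic decomposition of a radius. -/
theorem norm_le_dyadic_sum (hlam : 0 ≤ lam) (hf : IsInBH lam f h g) {u : ℂ} (hu : ‖u‖ = 1)
    (N : ℕ) {ρ : ℝ} (h1 : (1 / 2 : ℝ) ^ (N + 1) ≤ 1 - ρ) (h2 : 1 - ρ ≤ (1 / 2 : ℝ) ^ N) :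
    ‖f (ρ * u)‖ ≤ ∑ k ∈ Finset.range (N + 1),
      Real.exp (lam + 1) * ‖deriv h ((1 - (1 / 2 : ℝ) ^ k : ℝ) * u)‖ * (1 / 2 : ℝ) ^ k := by
  have step : ∀ (N : ℕ) (ρ : ℝ), (1 / 2 : ℝ) ^ (N + 1) ≤ 1 - ρ → 1 - ρ ≤ (1 / 2 : ℝ) ^ N →
      ‖f (ρ * u) - f ((1 - (1 / 2 : ℝ) ^ N : ℝ) * u)‖ ≤
        Real.exp (lam + 1) * ‖deriv h ((1 - (1 / 2 : ℝ) ^ N : ℝ) * u)‖ * (1 / 2 : ℝ) ^ N := by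
    intro N ρ h1 h2
    have h3 : (1 / 2 : ℝ) ^ N ≤ 1 := pow_le_one₀ (by norm_num) (by norm_num)
    have h4 : 0 < (1 / 2 : ℝ) ^ N := by positivity
    rw [pow_succ] at h1
    have := hf.norm_radial_sub_le hlam hu (s := 1 - (1 / 2 : ℝ) ^ N) (ρ := ρ) (by linarith)
      (by linarith) (by linarith) (by linarith)
    rwa [sub_sub_cancel] at this
  induction N generalizing ρ with
  | zero => simpa [hf.map_zero] using step 0 ρ h1 h2
  | succ N ih =>
    rw [Finset.sum_range_succ]
    have h3 := ih (ρ := 1 - (1 / 2 : ℝ) ^ (N + 1)) (by rw [sub_sub_cancel])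
      (by rw [sub_sub_cancel]; exact pow_le_pow_of_le_one (by norm_num) (by norm_num) N.le_succ)
    have h4 := step (N + 1) ρ h1 h2
    have h5 := norm_sub_norm_le (f (ρ * u)) (f ((1 - (1 / 2 : ℝ) ^ (N + 1) : ℝ) * u))
    linarith

/-- The `p`-th power of the `k`-th dyadic term has mean of order at most `2^(k(β - p))`; the sum
over `k` is governed by its last term if `β > p` and bounded if `β < p`. Excluding `β = p` avoids a
geometric sum of ratio 1. -/
theorem exists_integralMean_self_le (hlam : 0 ≤ lam) (hf : IsInBH lam f h g) {p β : ℝ} (hp : 0 < p)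
    (hβ : alpha (p * (lam + 1) / 2) < β) (hne : β ≠ p) :
    ∃ C : ℝ, ∀ r : ℝ, 0 ≤ r → r < 1 → integralMean p r f ≤ C * (1 - r) ^ (min (p - β) 0) := by
  obtain ⟨C, hC0, hC⟩ := hf.exists_integralMean_deriv_le hlam (p := p) (β := β)
    (by rwa [abs_of_pos hp])
  have hG := hf.logDerivBound_deriv hlam
  -- The weights `y^k = 2^(ηk)` split the exponent evenly: the `p`-th power of the weight sum and
  -- the weighted sum of means each contribute half of `β - p`.
  set η : ℝ := (β - p) / (2 * p) with hη
  have hηp : η * p = (β - p) / 2 := by rw [hη]; field_simp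
  set y : ℝ := 2 ^ η with hy
  have hy0 : 0 < y := by positivity
  have hη0 : η ≠ 0 := div_ne_zero (sub_ne_zero.mpr hne) (by positivity)
  have h2e : ∀ e : ℝ, e ≠ 0 → (2 : ℝ) ^ e ≠ 1 := fun e he => by
    rcases lt_or_gt_of_ne he with h | h
    · exact (Real.rpow_lt_one_of_one_lt_of_neg (by norm_num) h).ne
    · exact (Real.one_lt_rpow (by norm_num) h).ne'
  have hy1 : y ≠ 1 := h2e η hη0
  have hyp : y ^ p ≠ 1 := by
    rw [hy, ← Real.rpow_mul (by norm_num)]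
    exact h2e _ (mul_ne_zero hη0 hp.ne')
  obtain ⟨K₁, hK₁, hs₁⟩ := exists_geom_sum_le hy0 hy1
  obtain ⟨K₂, hK₂, hs₂⟩ := exists_geom_sum_le (Real.rpow_pos_of_pos hy0 p) hyp
  set A : ℝ := Real.exp (lam + 1) with hA
  have hA0 : 0 < A := Real.exp_pos _
  refine ⟨K₁ ^ p * (A ^ p * C * K₂), fun r hr hr1 => ?_⟩
  obtain ⟨N, hN1, hN2⟩ := exists_nat_pow_near_of_lt_one (show 0 < 1 - r by linarith)
    (show 1 - r ≤ 1 by linarith) (show (0 : ℝ) < 1 / 2 by norm_num) (by norm_num)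
  have hq0 : ∀ k : ℕ, 0 < (1 / 2 : ℝ) ^ k := fun k => by positivity
  have hq1 : ∀ k : ℕ, (1 / 2 : ℝ) ^ k ≤ 1 := fun k => pow_le_one₀ (by norm_num) (by norm_num)
  set ρ : ℕ → ℝ := fun k => 1 - (1 / 2 : ℝ) ^ k with hρ
  have hρ0 : ∀ k, 0 ≤ ρ k := fun k => by linarith [hq1 k]
  have hρ1 : ∀ k, ρ k < 1 := fun k => by linarith [hq0 k]
  set S₁ : ℝ := ∑ k ∈ Finset.range (N + 1), y ^ k with hS₁
  set c : ℕ → ℝ := fun k => (A * (1 / 2 : ℝ) ^ k / y ^ k) ^ p with hc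
  have hpt : ∀ θ : ℝ, ‖f (circleMap 0 r θ)‖ ^ p ≤
      S₁ ^ p * ∑ k ∈ Finset.range (N + 1), c k * ‖deriv h (circleMap 0 (ρ k) θ)‖ ^ p := fun θ => by
    have hu : ‖Complex.exp (θ * Complex.I)‖ = 1 := Complex.norm_exp_ofReal_mul_I θ
    have h1 := hf.norm_le_dyadic_sum hlam hu N hN1.le hN2
    simp only [circleMap, zero_add]
    refine (Real.rpow_le_rpow (norm_nonneg _) h1 hp.le).trans ((rpow_sum_le_weighted _
      (w := fun k => y ^ k) (fun k _ => by positivity) (fun k _ => by positivity) hp).trans_eq ?_)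
    congr 1
    refine Finset.sum_congr rfl fun k _ => ?_
    rw [hc, ← Real.mul_rpow (by positivity) (norm_nonneg _)]
    congr 1
    ring
  have hcont : ∀ (F : ℂ → ℂ), ContinuousOn F disk → ∀ s, 0 ≤ s → s < 1 →
      Continuous fun θ => ‖F (circleMap 0 s θ)‖ ^ p := fun F hF s hs hs1 =>
    (hF.comp_continuous (continuous_circleMap 0 s)
      (circleMap_mem_disk hs hs1)).norm.rpow_const fun _ => Or.inr hp.le
  have hck := fun k => hcont (deriv h) hG.differentiableOn.continuousOn (ρ k) (hρ0 k) (hρ1 k)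
  have hmean : integralMean p r f ≤
      S₁ ^ p * ∑ k ∈ Finset.range (N + 1), c k * integralMean p (ρ k) (deriv h) := by
    have h1 : ∫ θ in (0)..(2 * Real.pi), ‖f (circleMap 0 r θ)‖ ^ p ≤
        ∫ θ in (0)..(2 * Real.pi), S₁ ^ p *
          ∑ k ∈ Finset.range (N + 1), c k * ‖deriv h (circleMap 0 (ρ k) θ)‖ ^ p :=
      intervalIntegral.integral_mono_on (by positivity)
        ((hcont f hf.continuousOn r hr hr1).intervalIntegrable _ _)
        (Continuous.intervalIntegrable (continuous_const.mul
          (continuous_finsetSum _ fun k _ => continuous_const.mul (hck k))) _ _)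
        fun θ _ => hpt θ
    rw [intervalIntegral.integral_const_mul, intervalIntegral.integral_finsetSum
      fun k _ => ((hck k).intervalIntegrable _ _).const_mul _] at h1
    simp only [intervalIntegral.integral_const_mul] at h1
    have h2 := mul_le_mul_of_nonneg_left h1 (show 0 ≤ (2 * Real.pi)⁻¹ by positivity)
    refine h2.trans_eq ?_
    rw [mul_left_comm, Finset.mul_sum]
    congr 1
    refine Finset.sum_congr rfl fun k _ => ?_
    rw [integralMean, Real.circleAverage_def, smul_eq_mul]
    ring
  have hterm : ∀ k, c k * integralMean p (ρ k) (deriv h) ≤ A ^ p * C * (y ^ p) ^ k := fun k => by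
    have hck0 : 0 ≤ c k := by positivity
    refine (mul_le_mul_of_nonneg_left (hC (ρ k) (hρ0 k) (hρ1 k)) hck0).trans_eq ?_
    have e1 : (1 / 2 : ℝ) ^ k = 2 ^ (-(k : ℝ)) := by
      rw [Real.rpow_neg (by norm_num), Real.rpow_natCast, one_div, inv_pow]
    have e2 : y ^ k = 2 ^ (η * k) := by rw [Real.rpow_mul_natCast (by norm_num)]
    have e3 : (y ^ p) ^ k = 2 ^ (η * p * k) := by
      rw [Real.rpow_mul_natCast (by norm_num), Real.rpow_mul (by norm_num)]
    simp only [hc, hρ, sub_sub_cancel]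
    rw [mul_div_assoc, Real.mul_rpow hA0.le (by positivity), e3, e2, e1,
      ← Real.rpow_sub (by norm_num), ← Real.rpow_mul (by norm_num), ← Real.rpow_mul (by norm_num),
      mul_assoc, mul_assoc, mul_left_comm _ C, ← Real.rpow_add (by norm_num)]
    congr 3
    linear_combination (-2 * (k : ℝ)) * hηp
  have hsum : ∑ k ∈ Finset.range (N + 1), c k * integralMean p (ρ k) (deriv h) ≤
      A ^ p * C * (K₂ * max 1 (y ^ p) ^ N) := by
    refine (Finset.sum_le_sum fun k _ => hterm k).trans ?_
    rw [← Finset.mul_sum]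
    have := hs₂ N
    gcongr
  have hS₁0 : 0 ≤ S₁ := Finset.sum_nonneg fun k _ => by positivity
  have hfin : integralMean p r f ≤
      (K₁ * max 1 y ^ N) ^ p * (A ^ p * C * (K₂ * max 1 (y ^ p) ^ N)) := by
    have h0 : 0 ≤ ∑ k ∈ Finset.range (N + 1), c k * integralMean p (ρ k) (deriv h) :=
      Finset.sum_nonneg fun k _ => mul_nonneg (by positivity) (integralMean_nonneg _ _ _)
    refine hmean.trans ?_
    have := hs₁ N
    gcongr
  have hmax : ((max 1 y) ^ N) ^ p * max 1 (y ^ p) ^ N ≤ (1 - r) ^ (min (p - β) 0) := by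
    rcases lt_or_gt_of_ne hne with hlt | hgt
    · have hη' : η < 0 := div_neg_of_neg_of_pos (by linarith) (by positivity)
      have hyl : y ≤ 1 := Real.rpow_le_one_of_one_le_of_nonpos (by norm_num) hη'.le
      rw [max_eq_left hyl, max_eq_left (Real.rpow_le_one hy0.le hyl hp.le),
        min_eq_right (by linarith)]
      simp
    · have hη' : 0 < η := div_pos (by linarith) (by positivity)
      have hyl : 1 ≤ y := Real.one_le_rpow (by norm_num) hη'.le
      rw [max_eq_right hyl, max_eq_right (Real.one_le_rpow hyl hp.le), min_eq_left (by linarith)]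
      have e : (y ^ N) ^ p * (y ^ p) ^ N = ((1 / 2 : ℝ) ^ N) ^ (p - β) := by
        have e1 : (1 / 2 : ℝ) ^ N = 2 ^ (-(N : ℝ)) := by
          rw [Real.rpow_neg (by norm_num), Real.rpow_natCast, one_div, inv_pow]
        have e2 : y ^ N = 2 ^ (η * N) := by rw [Real.rpow_mul_natCast (by norm_num)]
        have e3 : (y ^ p) ^ N = 2 ^ (η * p * N) := by
          rw [Real.rpow_mul_natCast (by norm_num), Real.rpow_mul (by norm_num)]
        rw [e1, e2, e3, ← Real.rpow_mul (by norm_num), ← Real.rpow_mul (by norm_num),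
          ← Real.rpow_add (by norm_num)]
        congr 1
        linear_combination (2 * (N : ℝ)) * hηp
      rw [e]
      exact Real.rpow_le_rpow_of_nonpos (by linarith) hN2 (by linarith)
  refine hfin.trans ?_
  rw [Real.mul_rpow hK₁ (by positivity)]
  calc K₁ ^ p * ((max 1 y) ^ N) ^ p * (A ^ p * C * (K₂ * max 1 (y ^ p) ^ N))
      = K₁ ^ p * (A ^ p * C * K₂) * (((max 1 y) ^ N) ^ p * max 1 (y ^ p) ^ N) := by ring
    _ ≤ _ := by gcongr

theorem integralMean_isBigO (hlam : 0 ≤ lam) (hf : IsInBH lam f h g) {p a : ℝ} (hp : 0 < p)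
    (ha : 0 < a) :
    (fun r : ℝ => integralMean p r f) =O[𝓝[<] 1]
      (fun r : ℝ => (1 - r) ^ (min (p - alpha (p * (lam + 1) / 2) - a) 0)) := by
  -- If `p ≥ α + a` the target exponent is `0`, and `a / 2` in place of `a` keeps `β` strictly below
  -- `p`.
  obtain ⟨β, hβ, hne, hmin⟩ : ∃ β, alpha (p * (lam + 1) / 2) < β ∧ β ≠ p ∧
      min (p - β) 0 = min (p - alpha (p * (lam + 1) / 2) - a) 0 := by
    rcases lt_or_ge p (alpha (p * (lam + 1) / 2) + a) with hlt | hge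
    · exact ⟨alpha (p * (lam + 1) / 2) + a, by linarith, hlt.ne', by rw [sub_sub]⟩
    · refine ⟨alpha (p * (lam + 1) / 2) + a / 2, by linarith, by linarith, ?_⟩
      rw [min_eq_right (by linarith), min_eq_right (by linarith)]
  obtain ⟨C, hC⟩ := hf.exists_integralMean_self_le hlam hp hβ hne
  refine IsBigO.of_bound C ?_
  filter_upwards [Ioo_mem_nhdsLT (show (0 : ℝ) < 1 by norm_num)] with r hr
  rw [Real.norm_of_nonneg (integralMean_nonneg _ _ _),
    Real.norm_of_nonneg (Real.rpow_nonneg (by linarith [hr.2]) _), ← hmin]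
  exact hC r hr.1.le hr.2

end IsInBH

end HarmonicDisk

theorem theorem7p2 (lam : ℝ) (hlam : 0 ≤ lam) (f h g : ℂ → ℂ)
    (hf : HarmonicDisk.IsInBH lam f h g) (a : ℝ) (ha : 0 < a) :
    (∀ p : ℝ, ∃ C : ℝ, ∀ᶠ r : ℝ in 𝓝[<] 1, ∀ ε : ℂ, ‖ε‖ ≤ 1 →
      HarmonicDisk.integralMean p r (fun z => deriv h z + ε * deriv g z) ≤
        C * (1 - r) ^ (-HarmonicDisk.alpha (|p| * (lam + 1) / 2) - a)) ∧
    (fun n : ℕ => ‖HarmonicDisk.taylorCoeff h n‖ + ‖HarmonicDisk.taylorCoeff g n‖) =O[atTop]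
      (fun n : ℕ => (n : ℝ) ^ (HarmonicDisk.alpha ((lam + 1) / 2) - 1 + a)) ∧
    (∀ p : ℝ, 0 < p →
      (fun r : ℝ => HarmonicDisk.integralMean p r f) =O[𝓝[<] 1]
        (fun r : ℝ => (1 - r) ^ (min (p - HarmonicDisk.alpha (p * (lam + 1) / 2) - a) 0))) := by
  refine ⟨fun p => ?_, ?_, fun p hp => hf.integralMean_isBigO hlam hp ha⟩
  · obtain ⟨C, hC⟩ := hf.exists_integralMean_le hlam
      (p := p) (β := HarmonicDisk.alpha (|p| * (lam + 1) / 2) + a) (by linarith)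
    refine ⟨C, ?_⟩
    filter_upwards [Ioo_mem_nhdsLT (show (0 : ℝ) < 1 by norm_num)] with r hr ε hε
    rw [← neg_add']
    exact hC r hr.1.le hr.2 ε hε
  · rw [sub_add_eq_add_sub]
    exact hf.taylorCoeff_isBigO hlam (by linarith)
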